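/- Let $K$ be a field, let $L\subseteq\mathbb Z^m$ be a nonzero subgroup of rank $r$ that is positive, i.e. $L\cap\mathbb N^m=\{0\}$, let $\rho:L\to K^*$ be a group homomorphism, and let $u_1,\dots,u_r\in L$. For $\alpha\in L$ write $\alpha=\alpha^+-\alpha^-$ with $\alpha^+,\alpha^-\in\mathbb N^m$ the positive and negative parts of $\alpha$, put $F_\rho(\alpha)=x^{\alpha^+}-\rho(\alpha)x^{\alpha^-}\in K[x_1,\dots,x_m]$, and let $I_{L,\rho}$ be the ideal generated by all $F_\rho(\alpha)$, $\alpha\in L$. Let $M(u_1,\dots,u_r)$ be the $r\times m$ integer matrix with rows $u_1,\dots,u_r$. Call an integer matrix mixed if every row has a positive and a negative entry, dominating if it contains no mixed $s\times s$ submatrix with $s\ge 1$ (the rows and the columns of a submatrix need not be consecutive), and mixed dominating if it is both. For a subgroup $H\subseteq\mathbb Z^m$ and a prime $p$ let $(H:p^\infty)=\{v\in\mathbb Z^m : p^kv\in H\text{ for some }k\in\mathbb N\}$. The following are equivalent: 1. $\operatorname{rad}(I_{L,\rho})=\operatorname{rad}(F_\rho(u_1),\dots,F_\rho(u_r))$.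 2. $M(u_1,\dots,u_r)$ is mixed dominating, and moreover $L=\sum_{i=1}^r\mathbb Z u_i$ if $\operatorname{char}K=0$, while $(L:p^\infty)=\left(\sum_{i=1}^r\mathbb Z u_i:p^\infty\right)$ if $\operatorname{char}K=p>0$. -/

import Mathlib

namespace LatticeIdeals

/-- The binomial `F_ρ(α) = x^{α⁺} - ρ(α) x^{α⁻}` attached to a partial character
`ρ : L → K^*` on `ℤ^m` and an element `α` of the lattice `L`; the `i`-th entries of
`α⁺` and `α⁻` are `(α i).toNat = max (α i) 0` and `(-α i).toNat = max (-α i) 0`. -/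
noncomputable def binomial {m : ℕ} {K : Type*} [Field K] (L : AddSubgroup (Fin m → ℤ))
    (ρ : Multiplicative L →* Kˣ) (α : L) : MvPolynomial (Fin m) K :=
  (∏ i, MvPolynomial.X i ^ ((α : Fin m → ℤ) i).toNat)
    - MvPolynomial.C (ρ (Multiplicative.ofAdd α) : K)
      * ∏ i, MvPolynomial.X i ^ (-(α : Fin m → ℤ) i).toNat

/-- The lattice ideal `I_{L,ρ}`, generated by all binomials `F_ρ(α)` with `α ∈ L`. -/
noncomputable def latticeIdeal {m : ℕ} {K : Type*} [Field K] (L : AddSubgroup (Fin m → ℤ))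
    (ρ : Multiplicative L →* Kˣ) : Ideal (MvPolynomial (Fin m) K) :=
  Ideal.span (Set.range (binomial L ρ))

/-- A lattice `L ⊆ ℤ^m` is positive if `L ∩ ℕ^m = {0}`. -/
def IsPositive {m : ℕ} (L : AddSubgroup (Fin m → ℤ)) : Prop :=
  ∀ v ∈ L, (∀ i, 0 ≤ v i) → v = 0

/-- The lattice `(L : p^∞) = {u ∈ ℤ^m | p^k u ∈ L for some k ∈ ℕ}`. -/
def saturation {m : ℕ} (L : AddSubgroup (Fin m → ℤ)) (p : ℕ) : AddSubgroup (Fin m → ℤ) where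
  carrier := {u | ∃ k : ℕ, p ^ k • u ∈ L}
  zero_mem' := ⟨0, by simp⟩
  add_mem' := by
    rintro a b ⟨k, hk⟩ ⟨l, hl⟩
    refine ⟨k + l, ?_⟩
    rw [smul_add]
    refine L.add_mem ?_ ?_
    · rw [pow_add, mul_comm, mul_smul]
      exact L.nsmul_mem hk _
    · rw [pow_add, mul_smul]
      exact L.nsmul_mem hl _
  neg_mem' := by
    rintro a ⟨k, hk⟩
    exact ⟨k, by rw [smul_neg]; exact L.neg_mem hk⟩

/-- An integer matrix is mixed if every row has a positive and a negative entry. -/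
def IsMixed {ι κ : Type*} (M : Matrix ι κ ℤ) : Prop :=
  ∀ i, (∃ j, 0 < M i j) ∧ (∃ j, M i j < 0)

/-- An integer matrix is dominating if it contains no (nonempty) square mixed submatrix.
The submatrix is obtained by choosing `s ≥ 1` distinct rows and `s` distinct columns; the order
in which they are listed does not affect mixedness. -/
def IsDominating {ι κ : Type*} (M : Matrix ι κ ℤ) : Prop :=
  ∀ s : ℕ, 1 ≤ s → ∀ (f : Fin s ↪ ι) (g : Fin s ↪ κ), ¬ IsMixed (M.submatrix f g)

end LatticeIdeals

/-! By the Nullstellensatz, equality of radicals means equality of zero sets over an algebraic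
closure `F`. A point is a pair `(T, χ)`: its zero coordinates and a character of `ℤ^m`. At it,
`F_ρ(α)` vanishes iff `α` has both signs on `T`, or `α` is zero on `T` and `χ` agrees with `ρ` at
`α` (`aeval_toricPoint_eq_zero_iff`). For 2 ⇒ 1, write `p^k α = ∑ n_i u_i`, `p` the exponential
characteristic. If some `u_i` with `n_i ≠ 0` is mixed on `T`, dominance forces both signs on `α`;
otherwise `α` is zero on `T` and the characters agree, as Frobenius is injective. For 1 ⇒ 2, `T = ∅`
gives the lattice condition, because characters separate a subgroup from everything outside its
`p`-saturation. Rank then makes the `u_i` independent, and positivity makes them mixed. If dominance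
failed, a maximal mixed block would make some nonzero multiple of a unit vector of `ℤ^T` the
restriction of an element of `L`, which is neither zero nor mixed on `T`. -/

namespace LatticeIdeals

/-! ### Combinatorics of mixed and dominating matrices -/

section Dominating

variable {ι κ : Type*}

/-- In a dominating matrix, rows that are mixed on a set of columns have a column in that set
whose nonzero entries, after multiplying the rows by arbitrary nonzero integers, are positive. -/
theorem IsDominating.exists_col [Finite ι] {M : Matrix ι κ ℤ} (hM : IsDominating M)
    (B : Set ι) (hB : B.Nonempty) (T : Set κ)
    (hmix : ∀ i ∈ B, (∃ j ∈ T, 0 < M i j) ∧ ∃ j ∈ T, M i j < 0)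
    (n : ι → ℤ) (hn : ∀ i ∈ B, n i ≠ 0) :
    ∃ j ∈ T, (∀ i ∈ B, 0 ≤ n i * M i j) ∧ ∃ i ∈ B, 0 < n i * M i j := by
  classical
  by_contra! hcon
  have hf : ∀ i : B, ∃ j ∈ T, 0 < n i * M i j := by
    rintro ⟨i, hi⟩
    obtain ⟨⟨j, hj, hjp⟩, ⟨k, hk, hkn⟩⟩ := hmix i hi
    rcases lt_or_gt_of_ne (hn i hi) with h | h
    · exact ⟨k, hk, mul_pos_of_neg_of_neg h hkn⟩
    · exact ⟨j, hj, mul_pos h hjp⟩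
  choose f hfT hf using hf
  have hg : ∀ i : B, ∃ i' : B, n i' * M i' (f i) < 0 := by
    intro i
    by_contra! h
    exact absurd (hcon (f i) (hfT i) (fun i' hi' => h ⟨i', hi'⟩) i i.2) (not_le.2 (hf i))
  have hg' : ∃ g : κ → B, ∀ i : B, n (g (f i)) * M (g (f i)) (f i) < 0 := by
    have : ∀ j : κ, ∃ i' : B, (∃ i : B, f i = j) → n i' * M i' j < 0 := by
      intro j
      by_cases h : ∃ i : B, f i = j
      · obtain ⟨i, rfl⟩ := h
        obtain ⟨i', hi'⟩ := hg i
        exact ⟨i', fun _ => hi'⟩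
      · exact ⟨⟨hB.some, hB.some_mem⟩, fun h' => absurd h' h⟩
    choose g hg using this
    exact ⟨g, fun i => hg _ ⟨i, rfl⟩⟩
  obtain ⟨g, hg⟩ := hg'
  -- From a row, `f` picks a column with positive scaled entry, and `g` returns a row with negative
  -- scaled entry there. On the periodic points `h` is bijective, so `f` is injective and the rows
  -- `P` with columns `f(P)` form a square mixed submatrix.
  let h : B → B := g ∘ f
  let P := Function.periodicPts h
  have hbij : Set.BijOn h P P := Function.bijOn_periodicPts h
  have hPne : P.Nonempty := by
    obtain ⟨b, hb⟩ := hB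
    obtain ⟨a, c, hac, hne⟩ : ∃ a c, h^[a] ⟨b, hb⟩ = h^[c] ⟨b, hb⟩ ∧ a ≠ c := by
      simpa [Function.Injective] using not_injective_infinite_finite (h^[·] ⟨b, hb⟩)
    have key : ∀ a c : ℕ, a < c → h^[a] ⟨b, hb⟩ = h^[c] ⟨b, hb⟩ → P.Nonempty := by
      intro a c hlt heq
      refine ⟨h^[a] ⟨b, hb⟩, c - a, by omega, ?_⟩
      rw [Function.IsPeriodicPt, Function.IsFixedPt, ← Function.iterate_add_apply, heq]
      congr 2
      omega
    rcases lt_or_gt_of_ne hne with hlt | hlt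
    · exact key _ _ hlt hac
    · exact key _ _ hlt hac.symm
  have : Fintype P := Fintype.ofFinite P
  have : Nonempty P := hPne.to_subtype
  let e : Fin (Fintype.card P) ≃ P := (Fintype.equivFin P).symm
  have hfinj : Set.InjOn f P := fun a ha b hb hab => hbij.injOn ha hb (congrArg g hab)
  refine hM (Fintype.card P) Fintype.card_pos
    ⟨fun k => ((e k : B) : ι), fun a b hab => e.injective (Subtype.ext (Subtype.ext hab))⟩
    ⟨fun k => f (e k), fun a b hab =>
      e.injective (Subtype.ext (hfinj (e a).2 (e b).2 hab))⟩ ?_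
  intro k
  obtain ⟨i', hi', hi'k⟩ := hbij.surjOn (e k).2
  have h1 : 0 < n (e k : B) * M (e k : B) (f (e k)) := hf _
  have h2 : n (e k : B) * M (e k : B) (f i') < 0 := by
    have := hg i'
    have h3 : g (f i') = (e k : B) := hi'k
    rwa [h3] at this
  have h4 : (e (e.symm ⟨i', hi'⟩) : B) = i' := by simp
  rcases lt_or_gt_of_ne (hn _ (e k : B).2) with hneg | hpos
  · refine ⟨⟨e.symm ⟨i', hi'⟩, ?_⟩, ⟨k, ?_⟩⟩
    · change 0 < M (e k : B) (f (e (e.symm ⟨i', hi'⟩)))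
      rw [h4]; exact pos_of_mul_neg_right h2 hneg.le
    · exact neg_of_mul_pos_right h1 hneg.le
  · refine ⟨⟨k, ?_⟩, ⟨e.symm ⟨i', hi'⟩, ?_⟩⟩
    · exact pos_of_mul_pos_right h1 hpos.le
    · change M (e k : B) (f (e (e.symm ⟨i', hi'⟩))) < 0
      rw [h4]; exact neg_of_mul_neg_right h2 hpos.le

/-- A mixed matrix that is not dominating has a nonempty set `T` of columns such that at least
`#T` rows are mixed on `T` and all the other rows vanish on `T`. -/
theorem exists_mixed_block [Finite ι] [DecidableEq κ] {M : Matrix ι κ ℤ} (hmix : IsMixed M)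
    (hM : ¬ IsDominating M) :
    ∃ (B : Finset ι) (T : Finset κ), T.Nonempty ∧ T.card ≤ B.card ∧
      (∀ i ∈ B, (∃ j ∈ T, 0 < M i j) ∧ ∃ j ∈ T, M i j < 0) ∧
      ∀ i ∉ B, ∀ j ∈ T, M i j = 0 := by
  classical
  have := Fintype.ofFinite ι
  let good : Finset ι → Prop := fun B => ∃ T : Finset κ, T.Nonempty ∧ T.card ≤ B.card ∧
    ∀ i ∈ B, (∃ j ∈ T, 0 < M i j) ∧ ∃ j ∈ T, M i j < 0
  have hex : ∃ B, good B := by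
    simp only [IsDominating] at hM
    push Not at hM
    obtain ⟨s, hs, f, g, hfg⟩ := hM
    refine ⟨Finset.univ.map f, Finset.univ.map g, ?_, by simp, ?_⟩
    · exact ⟨g ⟨0, hs⟩, by simp⟩
    · intro i hi
      simp only [Finset.mem_map, Finset.mem_univ, true_and] at hi
      obtain ⟨a, rfl⟩ := hi
      obtain ⟨⟨j, hj⟩, ⟨k, hk⟩⟩ := hfg a
      exact ⟨⟨g j, by simp, hj⟩, ⟨g k, by simp, hk⟩⟩
  obtain ⟨B, hB, hmax⟩ := Finset.exists_max_image (Finset.univ.filter good) Finset.card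
    (by obtain ⟨B, hB⟩ := hex; exact ⟨B, by simpa using hB⟩)
  simp only [Finset.mem_filter, Finset.mem_univ, true_and] at hB hmax
  obtain ⟨T, hT, hTB, hBT⟩ := hB
  refine ⟨B, T, hT, hTB, hBT, ?_⟩
  intro i hi j hj
  by_contra hne
  -- A further row nonzero on `T` becomes mixed after adding at most one column, contradicting the
  -- maximality of `B`.
  have key : ∀ k : κ, ((∃ j ∈ insert k T, 0 < M i j) ∧ ∃ j ∈ insert k T, M i j < 0) → False := by
    intro k hk
    have := hmax (insert i B) ⟨insert k T, by simp, ?_, ?_⟩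
    · rw [Finset.card_insert_of_notMem hi] at this
      omega
    · rw [Finset.card_insert_of_notMem hi]
      exact (Finset.card_insert_le _ _).trans (by omega)
    · intro i' hi'
      rcases Finset.mem_insert.1 hi' with rfl | hi'
      · exact hk
      · obtain ⟨⟨a, ha, ha'⟩, ⟨b, hb, hb'⟩⟩ := hBT i' hi'
        exact ⟨⟨a, Finset.mem_insert_of_mem ha, ha'⟩, ⟨b, Finset.mem_insert_of_mem hb, hb'⟩⟩
  obtain ⟨⟨a, ha⟩, ⟨b, hb⟩⟩ := hmix i
  rcases lt_or_gt_of_ne hne with h | h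
  · exact key a ⟨⟨a, by simp, ha⟩, ⟨j, by simp [hj], h⟩⟩
  · exact key b ⟨⟨j, by simp [hj], h⟩, ⟨b, by simp, hb⟩⟩

end Dominating

/-! ### Characters with values in `Fˣ` -/

section Characters

variable {F : Type*} [Field F] [IsAlgClosed F]

/-- Roots exist in `F`, so `Fˣ` is divisible, hence injective over `ℤ`: characters extend from
subgroups. -/
theorem baer_units : Module.Baer ℤ (Additive Fˣ) := by
  have hdiv : ∀ {n : ℕ}, n ≠ 0 → Function.Surjective (fun a : Additive Fˣ => n • a) := by
    intro n hn a
    obtain ⟨z, hz⟩ := IsAlgClosed.exists_pow_nat_eq ((a.toMul : Fˣ) : F) (Nat.pos_of_ne_zero hn)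
    have hz0 : z ≠ 0 := by
      rintro rfl
      rw [zero_pow hn] at hz
      exact a.toMul.ne_zero hz.symm
    exact ⟨Additive.ofMul (Units.mk0 z hz0), Additive.toMul.injective (Units.ext (by simpa using hz))⟩
  let : DivisibleBy (Additive Fˣ) ℕ := divisibleByOfSMulRightSurj _ _ hdiv
  let : DivisibleBy (Additive Fˣ) ℤ := AddGroup.divisibleByIntOfDivisibleByNat _
  exact Module.Baer.of_divisible _

theorem exists_unit_of_prime {p l : ℕ} [ExpChar F p] (hl : l.Prime) (hlp : l ≠ p) :
    ∃ c : Additive Fˣ, c ≠ 0 ∧ (l : ℤ) • c = 0 := by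
  have hl0 : (l : F) ≠ 0 := by
    rcases ‹ExpChar F p› with _ | hp
    · exact_mod_cast hl.ne_zero
    · intro h
      exact hlp ((Nat.prime_dvd_prime_iff_eq hp hl).1 ((CharP.cast_eq_zero_iff F p l).1 h)).symm
  have : NeZero (l : F) := ⟨hl0⟩
  obtain ⟨ζ, hζ⟩ := HasEnoughRootsOfUnity.exists_primitiveRoot F l
  refine ⟨Additive.ofMul (Units.mk0 ζ (hζ.ne_zero hl.ne_zero)), ?_, ?_⟩
  · intro h
    apply hζ.ne_one hl.one_lt
    have := congrArg (fun a : Additive Fˣ => ((a.toMul : Fˣ) : F)) h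
    simpa using this
  · apply Additive.toMul.injective
    apply Units.ext
    simpa using hζ.pow_eq_one

/-- Characters with values in an algebraically closed field of exponential characteristic `p`
separate a subgroup from the elements outside its `p`-saturation. -/
theorem exists_character {p : ℕ} [ExpChar F p] {M : Type*} [AddCommGroup M] (H : Submodule ℤ M)
    (a : M) (ha : ∀ k : ℕ, p ^ k • a ∉ H) :
    ∃ ψ : M →ₗ[ℤ] Additive Fˣ, (∀ h ∈ H, ψ h = 0) ∧ ψ a ≠ 0 := by
  let φ : ℤ →ₗ[ℤ] M ⧸ H := LinearMap.toSpanSingleton ℤ (M ⧸ H) (H.mkQ a)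
  -- `n` is the order of `a` modulo `H`, with 0 for infinite order. It is no power of `p`, so a
  -- prime `l ≠ p` divides it and `a` can be sent to a nontrivial `l`-th root of unity.
  obtain ⟨n, hn⟩ : ∃ n : ℕ, ∀ z : ℤ, φ z = 0 ↔ (n : ℤ) ∣ z := by
    obtain ⟨g, hg⟩ := IsPrincipalIdealRing.principal (LinearMap.ker φ)
    refine ⟨g.natAbs, fun z => ?_⟩
    rw [← LinearMap.mem_ker, hg, Int.natAbs_dvd]
    exact Ideal.mem_span_singleton
  have hnp : ∀ k : ℕ, n ≠ p ^ k := by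
    rintro k rfl
    apply ha k
    have := (hn ((p ^ k : ℕ) : ℤ)).2 dvd_rfl
    rw [LinearMap.toSpanSingleton_apply, ← map_smul, Submodule.mkQ_apply,
      Submodule.Quotient.mk_eq_zero] at this
    exact_mod_cast this
  obtain ⟨l, hl, hlp, hln⟩ : ∃ l : ℕ, l.Prime ∧ l ≠ p ∧ l ∣ n := by
    by_cases h0 : n = 0
    · subst h0
      by_cases h2 : p = 2
      · exact ⟨3, Nat.prime_three, by omega, dvd_zero _⟩
      · exact ⟨2, Nat.prime_two, by omega, dvd_zero _⟩
    · by_contra! h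
      exact hnp _ (Nat.eq_prime_pow_of_unique_prime_dvd h0 fun {d} hd hdn => by
        by_contra hne
        exact h d hd hne hdn)
  obtain ⟨c, hc0, hc⟩ := exists_unit_of_prime (F := F) hl hlp
  let γ : ℤ →ₗ[ℤ] Additive Fˣ := LinearMap.toSpanSingleton ℤ _ c
  have hγ : LinearMap.ker φ ≤ LinearMap.ker γ := by
    intro z hz
    obtain ⟨w, rfl⟩ := (Int.natCast_dvd_natCast.2 hln).trans ((hn z).1 hz)
    rw [LinearMap.mem_ker, LinearMap.toSpanSingleton_apply, mul_comm, mul_smul, hc, smul_zero]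
  obtain ⟨ψ, hψ⟩ := Module.Baer.extension_property (baer_units (F := F))
    ((LinearMap.ker φ).liftQ φ le_rfl)
    (LinearMap.ker_eq_bot.1 (Submodule.ker_liftQ_eq_bot _ _ _ le_rfl))
    ((LinearMap.ker φ).liftQ γ hγ)
  refine ⟨ψ ∘ₗ H.mkQ, fun h hh => ?_, ?_⟩
  · rw [LinearMap.comp_apply, Submodule.mkQ_apply, (Submodule.Quotient.mk_eq_zero H).2 hh, map_zero]
  · have := LinearMap.congr_fun hψ ((LinearMap.ker φ).mkQ 1)
    change ψ ((1 : ℤ) • H.mkQ a) = (1 : ℤ) • c at this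
    rw [one_smul, one_smul] at this
    rwa [LinearMap.comp_apply, this]

end Characters

end LatticeIdeals

namespace LatticeIdeals

/-! ### Points, their zero sets, and the Nullstellensatz -/

section Points

variable {K : Type*} [Field K] {m : ℕ} (L : AddSubgroup (Fin m → ℤ)) (ρ : Multiplicative L →* Kˣ)
  (F : Type*) [Field F] [Algebra K F]

/-- The partial character `ρ`, with values in an extension field `F`, written additively. -/
noncomputable def additiveCharacter : L →ₗ[ℤ] Additive Fˣ :=
  (MonoidHom.toAdditiveRight ((Units.map (algebraMap K F : K →* F)).comp ρ)).toIntLinearMap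

variable {F}

/-- The point of `F ^ m` with zero set `T` whose other coordinates are the values of the
character `χ` of `ℤ ^ m` at the unit vectors. -/
noncomputable def toricPoint (T : Finset (Fin m)) (χ : (Fin m → ℤ) →ₗ[ℤ] Additive Fˣ) : Fin m → F :=
  fun j => if j ∈ T then 0 else ((χ (Pi.single j 1)).toMul : Fˣ)

theorem exists_eq_toricPoint (x : Fin m → F) : ∃ T χ, x = toricPoint T χ := by
  classical
  let y : Fin m → Additive Fˣ :=
    fun j => if h : x j = 0 then 0 else Additive.ofMul (Units.mk0 (x j) h)
  refine ⟨Finset.univ.filter fun j => x j = 0, (Pi.basisFun ℤ (Fin m)).constr ℤ y, ?_⟩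
  funext j
  have : ((Pi.basisFun ℤ (Fin m)).constr ℤ y) (Pi.single j 1) = y j := by
    rw [← Pi.basisFun_apply, Module.Basis.constr_basis]
  rw [toricPoint, this]
  by_cases h : x j = 0 <;> simp [h, y]

theorem coe_character_mul_prod (χ : (Fin m → ℤ) →ₗ[ℤ] Additive Fˣ) (α : Fin m → ℤ) :
    (((χ α).toMul : Fˣ) : F) * ∏ j, (((χ (Pi.single j 1)).toMul : Fˣ) : F) ^ (-α j).toNat =
      ∏ j, (((χ (Pi.single j 1)).toMul : Fˣ) : F) ^ (α j).toNat := by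
  have h : (χ α).toMul = ∏ j, (χ (Pi.single j 1)).toMul ^ (α j) := by
    conv_lhs => rw [pi_eq_sum_univ' α, map_sum, toMul_sum]
    refine Finset.prod_congr rfl fun j _ => ?_
    rw [map_smul, toMul_zsmul]
  rw [h, Units.coe_prod, ← Finset.prod_mul_distrib]
  refine Finset.prod_congr rfl fun j _ => ?_
  rw [Units.val_zpow_eq_zpow_val, ← zpow_natCast, ← zpow_natCast, ← zpow_add₀ (Units.ne_zero _)]
  congr 1
  omega

theorem prod_toricPoint_of_forall_eq_zero {T : Finset (Fin m)}
    (χ : (Fin m → ℤ) →ₗ[ℤ] Additive Fˣ) {e : Fin m → ℕ} (he : ∀ j ∈ T, e j = 0) :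
    ∏ j, toricPoint T χ j ^ e j = ∏ j, (((χ (Pi.single j 1)).toMul : Fˣ) : F) ^ e j := by
  refine Finset.prod_congr rfl fun j _ => ?_
  by_cases hj : j ∈ T
  · rw [he j hj, pow_zero, pow_zero]
  · rw [toricPoint, if_neg hj]

theorem prod_toricPoint_eq_zero_iff {T : Finset (Fin m)}
    (χ : (Fin m → ℤ) →ₗ[ℤ] Additive Fˣ) {e : Fin m → ℕ} :
    ∏ j, toricPoint T χ j ^ e j = 0 ↔ ∃ j ∈ T, e j ≠ 0 := by
  have h : ∀ j, toricPoint T χ j = 0 ↔ j ∈ T := fun j => by simp [toricPoint]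
  simp only [Finset.prod_eq_zero_iff, Finset.mem_univ, true_and, pow_eq_zero_iff', h, ne_eq]

theorem aeval_binomial (x : Fin m → F) (α : L) :
    MvPolynomial.aeval x (binomial L ρ α) =
      ∏ j, x j ^ ((α : Fin m → ℤ) j).toNat -
        ((additiveCharacter L ρ F α).toMul : Fˣ) * ∏ j, x j ^ (-(α : Fin m → ℤ) j).toNat := by
  simp [binomial, additiveCharacter, map_prod]

/-- A binomial vanishes at a point with zero set `T` if and only if either its exponent vanishes
on `T` and the characters agree, or its exponent has both signs on `T`. -/
theorem aeval_toricPoint_eq_zero_iff (T : Finset (Fin m))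
    (χ : (Fin m → ℤ) →ₗ[ℤ] Additive Fˣ) (α : L) :
    MvPolynomial.aeval (toricPoint T χ) (binomial L ρ α) = 0 ↔
      ((∀ j ∈ T, (α : Fin m → ℤ) j = 0) ∧ χ α = additiveCharacter L ρ F α) ∨
      ((∃ j ∈ T, 0 < (α : Fin m → ℤ) j) ∧ ∃ j ∈ T, (α : Fin m → ℤ) j < 0) := by
  rw [aeval_binomial]
  by_cases h0 : ∀ j ∈ T, (α : Fin m → ℤ) j = 0
  · have hno : ¬ ((∃ j ∈ T, 0 < (α : Fin m → ℤ) j) ∧ ∃ j ∈ T, (α : Fin m → ℤ) j < 0) := by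
      rintro ⟨⟨j, hj, hlt⟩, -⟩
      exact hlt.ne' (h0 j hj)
    rw [prod_toricPoint_of_forall_eq_zero χ (fun j hj => by rw [h0 j hj]; rfl),
      prod_toricPoint_of_forall_eq_zero χ (fun j hj => by rw [h0 j hj]; rfl),
      ← coe_character_mul_prod, sub_eq_zero, or_iff_left hno, and_iff_right h0]
    have hne : ∏ j, (((χ (Pi.single j 1)).toMul : Fˣ) : F) ^ (-(α : Fin m → ℤ) j).toNat ≠ 0 :=
      Finset.prod_ne_zero_iff.2 fun j _ => pow_ne_zero _ (Units.ne_zero _)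
    rw [mul_left_inj' hne, Units.val_inj]
    exact Additive.toMul.injective.eq_iff
  · rw [or_iff_right fun h => h0 h.1]
    have hP : ∏ j, toricPoint T χ j ^ ((α : Fin m → ℤ) j).toNat = 0 ↔
        ∃ j ∈ T, 0 < (α : Fin m → ℤ) j := by
      rw [prod_toricPoint_eq_zero_iff]
      simp
    have hN : ∏ j, toricPoint T χ j ^ (-(α : Fin m → ℤ) j).toNat = 0 ↔
        ∃ j ∈ T, (α : Fin m → ℤ) j < 0 := by
      rw [prod_toricPoint_eq_zero_iff]
      simp
    rw [← hP, ← hN]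
    constructor
    -- One of the two monomials vanishes; the coefficient is a unit, so the other must vanish too.
    · intro h
      have hor : (∃ j ∈ T, 0 < (α : Fin m → ℤ) j) ∨ ∃ j ∈ T, (α : Fin m → ℤ) j < 0 := by
        push Not at h0
        obtain ⟨j, hj, hne⟩ := h0
        rcases lt_or_gt_of_ne hne with h | h
        · exact Or.inr ⟨j, hj, h⟩
        · exact Or.inl ⟨j, hj, h⟩
      rcases hor with h' | h'
      · have h' := hP.2 h'
        rw [h', zero_sub, neg_eq_zero, mul_eq_zero, or_iff_right (Units.ne_zero _)] at h
        exact ⟨h', h⟩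
      · have h' := hN.2 h'
        rw [h', mul_zero, sub_zero] at h
        exact ⟨h, h'⟩
    · rintro ⟨h, h'⟩
      rw [h, h', mul_zero, sub_zero]

theorem radical_eq_radical_iff [IsAlgClosed F] {ι : Type*} (u : ι → L) :
    (latticeIdeal L ρ).radical =
        (Ideal.span (Set.range fun i => binomial L ρ (u i))).radical ↔
      ∀ x : Fin m → F, (∀ i, MvPolynomial.aeval x (binomial L ρ (u i)) = 0) →
        ∀ α, MvPolynomial.aeval x (binomial L ρ α) = 0 := by
  have hle : Ideal.span (Set.range fun i => binomial L ρ (u i)) ≤ latticeIdeal L ρ :=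
    Ideal.span_mono (Set.range_subset_iff.2 fun i => ⟨u i, rfl⟩)
  constructor
  · intro h x hx α
    have hmem : binomial L ρ α ∈ (latticeIdeal L ρ).radical :=
      Ideal.le_radical (Ideal.subset_span ⟨α, rfl⟩)
    rw [h] at hmem
    refine MvPolynomial.radical_le_vanishingIdeal_zeroLocus (K := F) _ hmem x ?_
    rw [MvPolynomial.zeroLocus_span]
    rintro _ ⟨i, rfl⟩
    exact hx i
  · intro h
    refine le_antisymm ?_ (Ideal.radical_mono hle)
    rw [← MvPolynomial.vanishingIdeal_zeroLocus_eq_radical (K := F),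
      ← MvPolynomial.vanishingIdeal_zeroLocus_eq_radical (K := F)]
    refine MvPolynomial.vanishingIdeal_anti_mono ?_
    rw [latticeIdeal, MvPolynomial.zeroLocus_span, MvPolynomial.zeroLocus_span]
    rintro x hx _ ⟨α, rfl⟩
    exact h x (fun i => hx _ ⟨i, rfl⟩) α

end Points

end LatticeIdeals

namespace LatticeIdeals

/-! ### From zero sets to lattice conditions and back -/

section Lattice

variable {K : Type*} [Field K] {m r : ℕ} {L : AddSubgroup (Fin m → ℤ)}
  {ρ : Multiplicative L →* Kˣ} {F : Type*} [Field F] [Algebra K F]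

theorem expChar_pow_smul_eq_zero {p : ℕ} [ExpChar F p] {k : ℕ} {a : Additive Fˣ}
    (h : p ^ k • a = 0) : a = 0 := by
  apply Additive.toMul.injective
  apply Units.ext
  apply iterateFrobenius_inj F p k
  have := congrArg (fun b : Additive Fˣ => ((b.toMul : Fˣ) : F)) h
  simpa [iterateFrobenius_def] using this

/-- An integer combination of rows each of which is zero or mixed on `T` takes a positive value
on `T`, provided the matrix is dominating and some mixed row has a nonzero coefficient. -/
theorem IsDominating.exists_sum_pos {ι κ : Type*} [Fintype ι] {M : Matrix ι κ ℤ}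
    (hM : IsDominating M) (T : Finset κ)
    (hT : ∀ i, (∀ j ∈ T, M i j = 0) ∨ ((∃ j ∈ T, 0 < M i j) ∧ ∃ j ∈ T, M i j < 0))
    (n : ι → ℤ) (hn : ∃ i, n i ≠ 0 ∧ ¬ ∀ j ∈ T, M i j = 0) :
    ∃ j ∈ T, 0 < ∑ i, n i * M i j := by
  obtain ⟨j, hj, hnonneg, i₀, hi₀, hpos⟩ :=
    hM.exists_col {i | n i ≠ 0 ∧ ¬ ∀ j ∈ T, M i j = 0} hn T
      (fun i hi => (hT i).resolve_left hi.2) n (fun i hi => hi.1)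
  refine ⟨j, hj, Finset.sum_pos' (fun i _ => ?_) ⟨i₀, Finset.mem_univ _, hpos⟩⟩
  by_cases hi : n i ≠ 0 ∧ ¬ ∀ j ∈ T, M i j = 0
  · exact hnonneg i hi
  · rcases not_and_or.1 hi with h | h
    · rw [not_not.1 h, zero_mul]
    · rw [not_not.1 h j hj, mul_zero]

theorem aeval_binomial_eq_zero_of_isDominating {p : ℕ} [ExpChar F p] (u : Fin r → L)
    (hM : IsDominating (Matrix.of fun i j => (u i : Fin m → ℤ) j))
    (hsat : ∀ α : L, ∃ k : ℕ, p ^ k • α ∈ Submodule.span ℤ (Set.range u))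
    (x : Fin m → F) (hx : ∀ i, MvPolynomial.aeval x (binomial L ρ (u i)) = 0) (α : L) :
    MvPolynomial.aeval x (binomial L ρ α) = 0 := by
  obtain ⟨T, χ, rfl⟩ := exists_eq_toricPoint x
  simp only [aeval_toricPoint_eq_zero_iff] at hx ⊢
  obtain ⟨k, hk⟩ := hsat α
  obtain ⟨n, hn⟩ := (Submodule.mem_span_range_iff_exists_fun ℤ).1 hk
  have hp : (0 : ℤ) < p ^ k := by
    exact_mod_cast pow_pos (expChar_pos F p) k
  have hcoord : ∀ j, ∑ i, n i * (u i : Fin m → ℤ) j = (p : ℤ) ^ k * (α : Fin m → ℤ) j := by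
    intro j
    have := congrArg (fun v : L => (v : Fin m → ℤ) j) hn
    simpa [Finset.sum_apply] using this
  have hT := fun i => (hx i).imp And.left id
  by_cases hne : ∃ i, n i ≠ 0 ∧ ¬ ∀ j ∈ T, (u i : Fin m → ℤ) j = 0
  · right
    obtain ⟨j, hj, hpos⟩ := hM.exists_sum_pos T hT n hne
    -- Negated coefficients give the negative entry.
    obtain ⟨l, hl, hneg⟩ := hM.exists_sum_pos T hT (fun i => - n i)
      (by simpa only [ne_eq, neg_eq_zero, Matrix.of_apply] using hne)
    simp only [Matrix.of_apply, neg_mul, Finset.sum_neg_distrib, hcoord] at hpos hneg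
    exact ⟨⟨j, hj, pos_of_mul_pos_right hpos hp.le⟩,
      ⟨l, hl, neg_of_mul_neg_right (neg_pos.1 hneg) hp.le⟩⟩
  · left
    push Not at hne
    have hzero : ∀ j ∈ T, (α : Fin m → ℤ) j = 0 := by
      intro j hj
      have hsum : ∑ i, n i * (u i : Fin m → ℤ) j = 0 := by
        refine Finset.sum_eq_zero fun i _ => ?_
        by_cases hi : n i = 0
        · rw [hi, zero_mul]
        · rw [hne i hi j hj, mul_zero]
      rw [hcoord] at hsum
      exact (mul_eq_zero.1 hsum).resolve_left hp.ne'
    refine ⟨hzero, ?_⟩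
    let δ : L →ₗ[ℤ] Additive Fˣ := χ ∘ₗ L.subtype.toIntLinearMap - additiveCharacter L ρ F
    have hδ : δ (p ^ k • α) = 0 := by
      rw [← hn, map_sum]
      refine Finset.sum_eq_zero fun i _ => ?_
      rw [map_smul]
      by_cases hi : n i = 0
      · rw [hi, zero_smul]
      · rcases hx i with ⟨-, h⟩ | ⟨⟨j, hj, hlt⟩, -⟩
        · have : δ (u i) = 0 := sub_eq_zero.2 h
          rw [this, smul_zero]
        · exact absurd (hne i hi j hj) hlt.ne'
    rw [map_nsmul] at hδ
    exact sub_eq_zero.1 (expChar_pow_smul_eq_zero hδ)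

variable [IsAlgClosed F]

theorem exists_extension_additiveCharacter (L : AddSubgroup (Fin m → ℤ))
    (ρ : Multiplicative L →* Kˣ) :
    ∃ χ : (Fin m → ℤ) →ₗ[ℤ] Additive Fˣ, ∀ α : L, χ α = additiveCharacter L ρ F α := by
  obtain ⟨χ, hχ⟩ := Module.Baer.extension_property (baer_units (F := F))
    L.subtype.toIntLinearMap L.subtype_injective (additiveCharacter L ρ F)
  exact ⟨χ, fun α => LinearMap.congr_fun hχ α⟩

/-- If the binomials of the `u i` cut out the zero set of the lattice ideal, `T` is a set of
coordinates on which each `u i` is zero or mixed, then every `α` in the lattice is zero or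
mixed on `T`, and in the former case it lies, up to a power of the exponential characteristic,
in the span of those `u i` vanishing on `T`. -/
theorem zero_or_mixed_of_zeroLocus {p : ℕ} [ExpChar F p] (u : Fin r → L)
    (hu : ∀ x : Fin m → F, (∀ i, MvPolynomial.aeval x (binomial L ρ (u i)) = 0) →
      ∀ α, MvPolynomial.aeval x (binomial L ρ α) = 0)
    (A : Set (Fin r)) (T : Finset (Fin m))
    (hA : ∀ i ∈ A, ∀ j ∈ T, (u i : Fin m → ℤ) j = 0)
    (hB : ∀ i ∉ A, (∃ j ∈ T, 0 < (u i : Fin m → ℤ) j) ∧ ∃ j ∈ T, (u i : Fin m → ℤ) j < 0)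
    (α : L) :
    ((∀ j ∈ T, (α : Fin m → ℤ) j = 0) ∧
        ∃ k : ℕ, p ^ k • α ∈ Submodule.span ℤ (u '' A)) ∨
      ((∃ j ∈ T, 0 < (α : Fin m → ℤ) j) ∧ ∃ j ∈ T, (α : Fin m → ℤ) j < 0) := by
  obtain ⟨χ₀, hχ₀⟩ := exists_extension_additiveCharacter (F := F) L ρ
  have key : ∀ ψ : (Fin m → ℤ) →ₗ[ℤ] Additive Fˣ, (∀ i ∈ A, ψ (u i) = 0) →
      ((∀ j ∈ T, (α : Fin m → ℤ) j = 0) ∧ ψ α = 0) ∨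
      ((∃ j ∈ T, 0 < (α : Fin m → ℤ) j) ∧ ∃ j ∈ T, (α : Fin m → ℤ) j < 0) := by
    intro ψ hψ
    -- Twisting an extension of `ρ` by any `ψ` killing the `u i` with `i ∈ A` stays in the zero set.
    have h := hu (toricPoint T (χ₀ + ψ)) (fun i => ?_) α
    · rw [aeval_toricPoint_eq_zero_iff] at h
      refine h.imp (And.imp_right fun h => ?_) id
      rw [LinearMap.add_apply, hχ₀] at h
      simpa using h
    · rw [aeval_toricPoint_eq_zero_iff]
      by_cases hi : i ∈ A
      · left
        refine ⟨hA i hi, ?_⟩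
        rw [LinearMap.add_apply, hχ₀, hψ i hi, add_zero]
      · exact Or.inr (hB i hi)
  rcases key 0 (fun _ _ => rfl) with ⟨h0, -⟩ | h
  · refine Or.inl ⟨h0, ?_⟩
    by_contra! hk
    let ι : L →ₗ[ℤ] (Fin m → ℤ) := L.subtype.toIntLinearMap
    obtain ⟨ψ, hψ, hψα⟩ := exists_character (F := F) (p := p)
      ((Submodule.span ℤ (u '' A)).map ι) (ι α) (fun k hmem => by
        obtain ⟨β, hβ, hβk⟩ := hmem
        rw [← map_nsmul] at hβk
        exact hk k ((show Function.Injective ι from L.subtype_injective) hβk ▸ hβ))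
    rcases key ψ (fun i hi => hψ _ ⟨u i, Submodule.subset_span ⟨i, hi, rfl⟩, rfl⟩) with h | h
    · exact hψα h.2
    · obtain ⟨⟨j, hj, hlt⟩, -⟩ := h
      exact hlt.ne' (h0 j hj)
  · exact Or.inr h

/-- The quotient by the span is torsion, so `r` vectors span rank `r`. -/
theorem linearIndependent_of_sat {p : ℕ} (hp : p ≠ 0) {M : Type*} [AddCommGroup M]
    [Module.Finite ℤ M] (u : Fin r → M) (hrank : Module.finrank ℤ M = r)
    (hsat : ∀ α : M, ∃ k : ℕ, p ^ k • α ∈ Submodule.span ℤ (Set.range u)) :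
    LinearIndependent ℤ u := by
  rw [linearIndependent_iff_card_eq_finrank_span, Fintype.card_fin, Set.finrank]
  have htors : Module.IsTorsion ℤ (M ⧸ Submodule.span ℤ (Set.range u)) := by
    intro x
    obtain ⟨α, rfl⟩ := Submodule.Quotient.mk_surjective _ x
    obtain ⟨k, hk⟩ := hsat α
    refine ⟨⟨(p ^ k : ℕ), mem_nonZeroDivisors_of_ne_zero (by exact_mod_cast pow_ne_zero k hp)⟩, ?_⟩
    change ((p ^ k : ℕ) : ℤ) •
      (Submodule.Quotient.mk α : M ⧸ Submodule.span ℤ (Set.range u)) = 0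
    rw [← Submodule.Quotient.mk_smul, Submodule.Quotient.mk_eq_zero, natCast_zsmul]
    exact hk
  have := Submodule.finrank_quotient_add_finrank (Submodule.span ℤ (Set.range u))
  rw [htors.finrank_eq_zero, zero_add, hrank] at this
  exact this.symm

theorem isMixed_of_linearIndependent (hpos : IsPositive L) (u : Fin r → L)
    (hu : LinearIndependent ℤ u) : IsMixed (Matrix.of fun i j => (u i : Fin m → ℤ) j) := by
  intro i
  have hne : (u i : Fin m → ℤ) ≠ 0 := fun h => hu.ne_zero i (Subtype.ext h)
  constructor
  · by_contra! h
    have := hpos (-(u i : Fin m → ℤ)) (L.neg_mem (u i).2) (fun j => neg_nonneg.2 (h j))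
    exact hne (neg_eq_zero.1 this)
  · by_contra! h
    exact hne (hpos _ (u i).2 h)

theorem isDominating_of_zeroLocus {p : ℕ} [ExpChar F p] (u : Fin r → L)
    (hu : ∀ x : Fin m → F, (∀ i, MvPolynomial.aeval x (binomial L ρ (u i)) = 0) →
      ∀ α, MvPolynomial.aeval x (binomial L ρ α) = 0)
    (hind : LinearIndependent ℤ u)
    (hmix : IsMixed (Matrix.of fun i j => (u i : Fin m → ℤ) j)) :
    IsDominating (Matrix.of fun i j => (u i : Fin m → ℤ) j) := by
  by_contra hdom
  obtain ⟨B, T, ⟨j₀, hj₀⟩, hTB, hBmix, hBzero⟩ := exists_mixed_block hmix hdom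
  have hzm := zero_or_mixed_of_zeroLocus (p := p) u hu {i | i ∉ B} T hBzero
    (fun i hi => hBmix i (not_not.1 hi))
  let res : L →ₗ[ℤ] (T → ℤ) := (LinearMap.funLeft ℤ ℤ Subtype.val) ∘ₗ L.subtype.toIntLinearMap
  have hres : ∀ (α : L) (j : T), res α j = (α : Fin m → ℤ) j := fun _ _ => rfl
  have hker : ∀ α : L, res α = 0 → ∃ k : ℕ, p ^ k • α ∈ Submodule.span ℤ (u '' {i | i ∉ B}) := by
    intro α hα
    rcases hzm α with h | ⟨⟨j, hj, hlt⟩, -⟩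
    · exact h.2
    · exact absurd (congrFun hα ⟨j, hj⟩) hlt.ne'
  have hdisj : Disjoint (Submodule.span ℤ (u '' B)) (Submodule.span ℤ (u '' {i | i ∉ B})) :=
    hind.disjoint_span_image (Set.disjoint_left.2 fun i hi hi' => hi' hi)
  have hp : ((p : ℤ)) ≠ 0 := by exact_mod_cast (expChar_pos F p).ne'
  let w : B → L := fun i => u i
  have hrange : Set.range w = u '' B := by
    ext; simp [w]
  -- A combination of rows in `B` vanishing on `T` has a `p`-power multiple in the span of the other
  -- rows, so it is zero.
  have hw : LinearIndependent ℤ (res ∘ w) := by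
    have hwind : LinearIndependent ℤ w := hind.comp _ Subtype.val_injective
    refine hwind.map ?_
    rw [Submodule.disjoint_def, hrange]
    intro α hα hα'
    obtain ⟨k, hk⟩ := hker α hα'
    have h0 := Submodule.disjoint_def.1 hdisj _ (Submodule.smul_of_tower_mem _ (p ^ k) hα) hk
    have h1 : ((p : ℤ) ^ k) • α = 0 := by
      rw [← h0, ← natCast_zsmul]; norm_cast
    exact (smul_eq_zero.1 h1).resolve_left (pow_ne_zero k hp)
  have hfin := finrank_span_eq_card hw
  have hadd := Submodule.finrank_quotient_add_finrank (Submodule.span ℤ (Set.range (res ∘ w)))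
  rw [Module.finrank_fintype_fun_eq_card, hfin, Fintype.card_coe, Fintype.card_coe] at hadd
  -- Since `#T ≤ #B`, the independent restrictions have full rank in `ℤ^T`.
  have htors := Module.finrank_eq_zero_iff_isTorsion.1
    (show Module.finrank ℤ ((T → ℤ) ⧸ Submodule.span ℤ (Set.range (res ∘ w))) = 0 by omega)
  classical
  obtain ⟨⟨N, hN⟩, hNe⟩ := @htors (Submodule.Quotient.mk (Pi.single ⟨j₀, hj₀⟩ 1))
  change N • (Submodule.Quotient.mk (Pi.single ⟨j₀, hj₀⟩ 1) :
    (T → ℤ) ⧸ Submodule.span ℤ (Set.range (res ∘ w))) = 0 at hNe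
  rw [← Submodule.Quotient.mk_smul, Submodule.Quotient.mk_eq_zero, Set.range_comp,
    ← Submodule.map_span] at hNe
  obtain ⟨α, -, hα⟩ := hNe
  have hαj : ∀ j (hj : j ∈ T), (α : Fin m → ℤ) j = if j = j₀ then N else 0 := by
    intro j hj
    rw [← hres α ⟨j, hj⟩, hα]
    simp [Pi.single_apply]
  have hN0 : N ≠ 0 := nonZeroDivisors.ne_zero hN
  rcases hzm α with ⟨h, -⟩ | ⟨⟨a, ha, hapos⟩, ⟨b, hb, hbneg⟩⟩
  · have := h j₀ hj₀
    rw [hαj j₀ hj₀, if_pos rfl] at this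
    exact hN0 this
  · rw [hαj a ha] at hapos
    rw [hαj b hb] at hbneg
    split_ifs at hapos hbneg <;> omega

end Lattice

theorem mem_span_range_iff_mem_closure {m : ℕ} {L : AddSubgroup (Fin m → ℤ)} {ι : Type*}
    (u : ι → L) (α : L) :
    α ∈ Submodule.span ℤ (Set.range u) ↔
      (α : Fin m → ℤ) ∈ AddSubgroup.closure (Set.range fun i => (u i : Fin m → ℤ)) := by
  have h1 : (Set.range fun i => (u i : Fin m → ℤ)) = L.subtype '' Set.range u := by
    rw [← Set.range_comp]; rfl
  rw [h1, ← AddMonoidHom.map_closure, ← Submodule.span_int_eq_addSubgroupClosure]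
  exact (L.subtype_injective.mem_set_image (s := (Submodule.span ℤ (Set.range u) : Set L))).symm

/-- The exponential characteristic treats both cases at once: in characteristic zero `p = 1`, and
saturation is trivial. -/
theorem forall_smul_mem_span_iff {K : Type*} [Field K] {m r p : ℕ} [ExpChar K p]
    (L : AddSubgroup (Fin m → ℤ)) (u : Fin r → L) :
    (∀ α : L, ∃ k : ℕ, p ^ k • α ∈ Submodule.span ℤ (Set.range u)) ↔
      (CharZero K → L = AddSubgroup.closure (Set.range fun i => (u i : Fin m → ℤ))) ∧
      (∀ p : ℕ, p.Prime → CharP K p → saturation L p =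
          saturation (AddSubgroup.closure (Set.range fun i => (u i : Fin m → ℤ))) p) := by
  have hle : AddSubgroup.closure (Set.range fun i => (u i : Fin m → ℤ)) ≤ L := by
    rw [AddSubgroup.closure_le]
    rintro _ ⟨i, rfl⟩
    exact (u i).2
  simp only [mem_span_range_iff_mem_closure, AddSubgroup.coe_nsmul]
  rcases ‹ExpChar K p› with _ | hp
  · have hno : ∀ q : ℕ, q.Prime → ¬ CharP K q := fun q hq _ =>
      hq.ne_zero (CharP.eq K ‹CharP K q› (CharP.ofCharZero K))
    simp only [one_pow, one_smul, exists_const]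
    constructor
    · exact fun h => ⟨fun _ => le_antisymm (fun v hv => h ⟨v, hv⟩) hle,
        fun q hq hc => absurd hc (hno q hq)⟩
    · rintro ⟨h, -⟩ α
      exact h inferInstance ▸ α.2
  · constructor
    · refine fun h => ⟨fun _ => ?_, fun q _ hc => ?_⟩
      · exact absurd (CharP.eq K ‹CharP K p› (CharP.ofCharZero K)) hp.ne_zero
      · obtain rfl := CharP.eq K hc ‹CharP K p›
        ext v
        constructor
        · rintro ⟨k, hk⟩
          obtain ⟨l, hl⟩ := h ⟨_, hk⟩
          exact ⟨l + k, by rwa [pow_add, mul_smul]⟩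
        · rintro ⟨k, hk⟩
          exact ⟨k, hle hk⟩
    · rintro ⟨-, h⟩ α
      have hmem : (α : Fin m → ℤ) ∈ saturation L p := ⟨0, by simp⟩
      rw [h p hp ‹CharP K p›] at hmem
      exact hmem

end LatticeIdeals

theorem theorem3p6 {K : Type*} [Field K] {m r : ℕ}
    (L : AddSubgroup (Fin m → ℤ)) (hL : L ≠ ⊥) (hpos : LatticeIdeals.IsPositive L)
    (hrank : Module.finrank ℤ L = r)
    (ρ : Multiplicative L →* Kˣ) (u : Fin r → L) :
    (LatticeIdeals.latticeIdeal L ρ).radical =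
        (Ideal.span (Set.range fun i : Fin r => LatticeIdeals.binomial L ρ (u i))).radical ↔
      (LatticeIdeals.IsMixed (Matrix.of fun i j => (u i : Fin m → ℤ) j) ∧
        LatticeIdeals.IsDominating (Matrix.of fun i j => (u i : Fin m → ℤ) j)) ∧
      (CharZero K → L = AddSubgroup.closure (Set.range fun i => (u i : Fin m → ℤ))) ∧
      (∀ p : ℕ, p.Prime → CharP K p →
        LatticeIdeals.saturation L p =
          LatticeIdeals.saturation
            (AddSubgroup.closure (Set.range fun i => (u i : Fin m → ℤ))) p) := by
  obtain ⟨p, hp⟩ := ExpChar.exists K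
  have : ExpChar (AlgebraicClosure K) p :=
    expChar_of_injective_algebraMap (algebraMap K (AlgebraicClosure K)).injective p
  rw [LatticeIdeals.radical_eq_radical_iff (F := AlgebraicClosure K),
    ← LatticeIdeals.forall_smul_mem_span_iff (K := K) (p := p) L u]
  constructor
  · intro h
    have hsat : ∀ α : L, ∃ k : ℕ, p ^ k • α ∈ Submodule.span ℤ (Set.range u) := by
      intro α
      -- `T = ∅` selects the points of the torus, where no sign condition can hold.
      rcases LatticeIdeals.zero_or_mixed_of_zeroLocus (p := p) u h Set.univ ∅
        (by simp) (by simp) α with h' | h'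
      · simpa using h'.2
      · simp at h'
    have : Module.Finite ℤ L :=
      inferInstanceAs (Module.Finite ℤ (AddSubgroup.toIntSubmodule L))
    have hind := LatticeIdeals.linearIndependent_of_sat (expChar_pos K p).ne' u hrank hsat
    have hmix := LatticeIdeals.isMixed_of_linearIndependent hpos u hind
    exact ⟨⟨hmix, LatticeIdeals.isDominating_of_zeroLocus (p := p) u h hind hmix⟩, hsat⟩
  · rintro ⟨⟨-, hdom⟩, hsat⟩
    exact LatticeIdeals.aeval_binomial_eq_zero_of_isDominating u hdom hsat
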